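/- Let $\mathbf{N}$ be the set of positive integers and let $\Sigma$ be the set of strictly increasing functions $\sigma:\mathbf{N}\to\mathbf{N}$, endowed with the topology inherited from the product space $\mathbf{N}^{\mathbf{N}}$ (where $\mathbf{N}$ is discrete). For a real sequence $x=(x_n)_{n\in\mathbf{N}}$ and $\sigma\in\Sigma$ write $\sigma(x):=(x_{\sigma(n)})_{n\in\mathbf{N}}$. For an infinite real matrix $A=(a_{n,k})_{n,k\in\mathbf{N}}$ and a real sequence $x$, the sequence $Ax$ is well defined if for each $n$ the series $\sum_k a_{n,k}x_k$ converges (that is, its partial sums have a finite limit), and then $Ax:=\left(\sum_k a_{n,k}x_k\right)_{n\in\mathbf{N}}$. The matrix $A$ is regular if for every real sequence $x$ converging to a real number $\ell$, the sequence $Ax$ is well defined and converges to $\ell$. A real sequence $y$ is statistically convergent if there is $\eta\in\mathbf{R}$ such that for every $\varepsilon>0$ $$\lim_{n\to\infty}\frac{|\{k\in\{1,\dots,n\}: |y_k-\eta|>\varepsilon\}|}{n}=0.$$ Then a real sequence $x$ is convergent (to a finite limit) if and only if there exists a regular matrix $A$ such that the set $$\{\sigma\in\Sigma : A\sigma(x)\text{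 is well defined and statistically convergent}\}$$ is not meager in $\Sigma$. -/

import Mathlib

open Filter Topology

/-! Sequences and infinite matrices are indexed by `ℕ = {0, 1, 2, …}`; the index `n` here plays the
role of the positive integer `n + 1`. -/

/-- The space of strictly increasing maps `ℕ → ℕ`, with the topology inherited from the product
`ℕ → ℕ` of discrete spaces. Its elements `σ` index the subsequences `x ∘ σ` of a sequence `x`. -/
abbrev IncreasingMaps : Type := {σ : ℕ → ℕ // StrictMono σ}

/-- `HasTransform A x y` says that `A x` is well defined and equal to `y`: for each row `n` the
series `∑ k, A n k * x k` converges (as the limit of its partial sums, possibly only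
conditionally) and has sum `y n`. -/
def HasTransform (A : Matrix ℕ ℕ ℝ) (x y : ℕ → ℝ) : Prop :=
  ∀ n, Tendsto (fun m => ∑ k ∈ Finset.range m, A n k * x k) atTop (𝓝 (y n))

/-- A matrix is regular if it maps convergent sequences to convergent sequences and preserves the
limits. -/
def IsRegularMatrix (A : Matrix ℕ ℕ ℝ) : Prop :=
  ∀ (x : ℕ → ℝ) (l : ℝ), Tendsto x atTop (𝓝 l) →
    ∃ y : ℕ → ℝ, HasTransform A x y ∧ Tendsto y atTop (𝓝 l)

/-- `S` has asymptotic density zero: the proportion of elements of `S` among the first `n` indices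
tends to `0`. -/
def HasDensityZero (S : Set ℕ) : Prop :=
  Tendsto (fun n : ℕ => ((S ∩ Set.Iio n).ncard : ℝ) / n) atTop (𝓝 0)

/-- The sequence `y` is statistically convergent (to some real number `η`). -/
def StatisticallyConvergent (y : ℕ → ℝ) : Prop :=
  ∃ η : ℝ, ∀ ε : ℝ, 0 < ε → HasDensityZero {n | ε < |y n - η|}

/-! If `x → l`, then every subsequence works for every regular matrix. Suppose that `x` diverges
and that `A` is regular. A behaviour of `A σ(x)` on long blocks of indices that can be achieved
after every finite initial segment of `σ` occurs, by Baire category, for generic `σ`. If `x` is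
bounded, it has two distinct cluster points; the rows of `A` are absolutely summable, so each
entry of `A σ(x)` depends continuously on `σ`, and generically `A σ(x)` is close to each of the
two on long blocks. If `x` is unbounded and some row of `A` has infinitely many nonzero entries,
the series of that row generically diverges; if all rows are finite, `A σ(x)` is generically as
large as desired on long blocks. In all cases statistical convergence fails. -/

open Set

/-- The set of `σ` for which `A σ(x)` is well defined and statistically convergent. -/
def statSummableSubseqs (A : Matrix ℕ ℕ ℝ) (x : ℕ → ℝ) : Set IncreasingMaps :=
  {σ | ∃ y : ℕ → ℝ, HasTransform A (fun n => x (σ.1 n)) y ∧ StatisticallyConvergent y}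

theorem hasDensityZero_of_finite {S : Set ℕ} (hS : S.Finite) : HasDensityZero S := by
  refine squeeze_zero (fun n => by positivity) (fun n => ?_)
    (tendsto_const_div_atTop_nhds_zero_nat (S.ncard : ℝ))
  have : (S ∩ Iio n).ncard ≤ S.ncard := ncard_le_ncard inter_subset_left hS
  gcongr

theorem statisticallyConvergent_of_tendsto {y : ℕ → ℝ} {l : ℝ} (h : Tendsto y atTop (𝓝 l)) :
    StatisticallyConvergent y := by
  refine ⟨l, fun ε hε => hasDensityZero_of_finite ?_⟩
  obtain ⟨N, hN⟩ := Metric.tendsto_atTop.1 h ε hε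
  exact (finite_Iio N).subset fun n hn => not_le.1 fun hNn => lt_asymm (hN n hNn) hn

/-- `S` contains blocks `[a, b)` with `b` arbitrarily large and `2 a ≤ b`. Such a block makes up at
least half of `[0, b)`, so `S` has upper density at least `1 / 2`. -/
def HasLongBlocks (S : Set ℕ) : Prop :=
  ∃ᶠ b in atTop, ∃ a, 2 * a ≤ b ∧ Ico a b ⊆ S

theorem HasLongBlocks.sdiff_nonempty {S T : Set ℕ} (hS : HasLongBlocks S)
    (hT : HasDensityZero T) : (S \ T).Nonempty := by
  rw [Set.sdiff_nonempty]
  intro hST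
  obtain ⟨b, ⟨a, hab, hblock⟩, hlt, hb⟩ := (hS.and_eventually
    ((hT.eventually (gt_mem_nhds one_half_pos)).and (eventually_gt_atTop 0))).exists
  have hcard : b - a ≤ (T ∩ Iio b).ncard := by
    rw [← Nat.card_Ico, ← ncard_coe_finset, Finset.coe_Ico]
    exact ncard_le_ncard (subset_inter (hblock.trans hST) fun n hn => hn.2)
      ((finite_Iio b).inter_of_right _)
  have hhalf : (b : ℝ) ≤ 2 * (T ∩ Iio b).ncard := by
    exact_mod_cast (by lia : b ≤ 2 * (T ∩ Iio b).ncard)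
  rw [div_lt_iff₀ (by exact_mod_cast hb)] at hlt
  linarith

theorem HasLongBlocks.dist_lt {y : ℕ → ℝ} {l η ε : ℝ} (hl : HasLongBlocks {n | dist (y n) l < ε})
    (hη : HasDensityZero {n | ε < |y n - η|}) : dist l η < 2 * ε := by
  obtain ⟨n, hnl, hnη⟩ := hl.sdiff_nonempty hη
  have hdl : dist (y n) l < ε := hnl
  have hdη : dist (y n) η ≤ ε := not_lt.1 hnη
  linarith [dist_triangle_left l η (y n)]

theorem isClosed_setOf_strictMono {ι α : Type*} [Preorder ι] [Preorder α] [TopologicalSpace α]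
    [DiscreteTopology α] : IsClosed {f : ι → α | StrictMono f} := by
  simp only [StrictMono, ofPred_forall]
  refine isClosed_iInter fun i => isClosed_iInter fun j => isClosed_iInter fun _ => ?_
  have hpair : Continuous fun f : ι → α => (f i, f j) := by fun_prop
  exact (isClosed_discrete {q : α × α | q.1 < q.2}).preimage hpair

namespace IncreasingMaps

instance : PolishSpace IncreasingMaps :=
  (isClosed_setOf_strictMono (ι := ℕ) (α := ℕ)).polishSpace

theorem continuous_comp_apply {X : Type*} [TopologicalSpace X] (x : ℕ → X) (k : ℕ) :
    Continuous fun σ : IncreasingMaps => x (σ.1 k) :=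
  continuous_of_discreteTopology.comp ((continuous_apply k).comp continuous_subtype_val)

theorem dense_of_forall_exists_eqOn {D : Set IncreasingMaps}
    (h : ∀ (σ : IncreasingMaps) (p : ℕ), ∃ τ ∈ D, EqOn τ.1 σ.1 (Iio p)) : Dense D := by
  intro σ
  choose τ hτD hτ using h σ
  refine mem_closure_of_tendsto (f := τ) (b := atTop) ?_ (Eventually.of_forall hτD)
  rw [tendsto_subtype_rng, tendsto_pi_nhds]
  refine fun j => tendsto_const_nhds.congr' ?_
  filter_upwards [eventually_gt_atTop j] with p hp
  exact (hτ p hp).symm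

theorem exists_eqOn_Iio_eqOn_Ici (σ τ : IncreasingMaps) {p : ℕ} (h : σ.1 p ≤ τ.1 p) :
    ∃ ρ : IncreasingMaps, EqOn ρ.1 σ.1 (Iio p) ∧ EqOn ρ.1 τ.1 (Ici p) := by
  have hmono : StrictMono fun j => if j < p then σ.1 j else τ.1 j :=
    σ.2.ite' τ.2 (fun _ _ hij hj => hij.trans hj) fun i j hi hj _ =>
      (σ.2 hi).trans_le (h.trans (τ.2.monotone (not_lt.1 hj)))
  exact ⟨⟨_, hmono⟩, fun j hj => if_pos hj, fun j hj => if_neg (not_lt.2 hj)⟩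

theorem exists_eqOn_Iio_apply_eq (σ : IncreasingMaps) {p m : ℕ} (hm : σ.1 p ≤ m) :
    ∃ τ : IncreasingMaps, EqOn τ.1 σ.1 (Iio p) ∧ τ.1 p = m := by
  have hshift : m - p + p = m := Nat.sub_add_cancel ((σ.2.le_apply).trans hm)
  obtain ⟨τ, hτσ, hτ⟩ := σ.exists_eqOn_Iio_eqOn_Ici
    ⟨fun j => m - p + j, fun _ _ hij => Nat.add_lt_add_left hij _⟩ (hm.trans_eq hshift.symm)
  exact ⟨τ, hτσ, (hτ self_mem_Ici).trans hshift⟩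

theorem exists_eqOn_Iio_tendsto {X : Type*} [TopologicalSpace X] [FirstCountableTopology X]
    {x : ℕ → X} {l : X} (hl : MapClusterPt l atTop x) (σ : IncreasingMaps) (p : ℕ) :
    ∃ τ : IncreasingMaps, EqOn τ.1 σ.1 (Iio p) ∧
      Tendsto (fun n => x (τ.1 n)) atTop (𝓝 l) := by
  obtain ⟨ψ, hψ, hlim⟩ := hl.tendsto_subseq
  have hshift : StrictMono fun j => σ.1 p + j := fun _ _ hij => Nat.add_lt_add_left hij _
  obtain ⟨τ, hτσ, hτ⟩ := σ.exists_eqOn_Iio_eqOn_Ici ⟨_, hψ.comp hshift⟩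
    ((Nat.le_add_right _ p).trans hψ.le_apply)
  refine ⟨τ, hτσ, (hlim.comp hshift.tendsto_atTop).congr' ?_⟩
  filter_upwards [eventually_ge_atTop p] with j hj
  exact congrArg x (hτ hj).symm

theorem eventually_residual_frequently_mem {U : ℕ → Set IncreasingMaps} (hU : ∀ k, IsOpen (U k))
    (h : ∀ (σ : IncreasingMaps) (p : ℕ), ∃ᶠ k in atTop, ∃ τ ∈ U k, EqOn τ.1 σ.1 (Iio p)) :
    ∀ᶠ σ in residual IncreasingMaps, ∃ᶠ k in atTop, σ ∈ U k := by
  simp only [frequently_atTop]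
  refine eventually_countable_forall.2 fun N => residual_of_dense_open ?_ ?_
  · simp only [ofPred_exists, ofPred_and]
    exact isOpen_iUnion fun k => isOpen_const.inter (hU k)
  · refine dense_of_forall_exists_eqOn fun σ p => ?_
    obtain ⟨k, hk, τ, hτU, hτ⟩ := frequently_atTop.1 (h σ p) N
    exact ⟨τ, ⟨k, hk, hτU⟩, hτ⟩

theorem eventually_residual_hasLongBlocks {U : ℕ → Set IncreasingMaps} (hU : ∀ n, IsOpen (U n))
    (h : ∀ (σ : IncreasingMaps) (p : ℕ), ∃ a, ∀ b, ∃ τ : IncreasingMaps,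
      EqOn τ.1 σ.1 (Iio p) ∧ ∀ n ∈ Ico a b, τ ∈ U n) :
    ∀ᶠ σ in residual IncreasingMaps, HasLongBlocks {n | σ ∈ U n} := by
  refine eventually_residual_frequently_mem
    (U := fun b => {σ | ∃ a, 2 * a ≤ b ∧ Ico a b ⊆ {n | σ ∈ U n}}) (fun b => ?_) fun σ p => ?_
  · simp only [ofPred_exists, ofPred_and, subset_def, ofPred_forall]
    exact isOpen_iUnion fun a =>
      isOpen_const.inter ((finite_Ico a b).isOpen_biInter fun n _ => hU n)
  · obtain ⟨a, ha⟩ := h σ p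
    refine (eventually_ge_atTop (2 * a)).frequently.mono fun b hb => ?_
    obtain ⟨τ, hτ, hblock⟩ := ha b
    exact ⟨τ, ⟨a, hb, hblock⟩, hτ⟩

end IncreasingMaps

theorem one_sub_div_le_sum_Ico_div {a : ℕ → ℝ} (ha : ∀ k, 0 ≤ a k) {N m : ℕ} (hNm : N ≤ m)
    (hm : 0 < ∑ i ∈ Finset.range m, a i) :
    1 - (∑ i ∈ Finset.range N, a i) / ∑ i ∈ Finset.range m, a i ≤
      ∑ k ∈ Finset.Ico N m, a k / ∑ i ∈ Finset.range (k + 1), a i := by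
  rw [one_sub_div hm.ne', ← Finset.sum_Ico_eq_sub _ hNm, Finset.sum_div]
  refine Finset.sum_le_sum fun k hk => ?_
  rcases (ha k).eq_or_lt with h0 | h0
  · simp [← h0]
  · have hpos : 0 < ∑ i ∈ Finset.range (k + 1), a i := h0.trans_le
      (Finset.single_le_sum (fun i _ => ha i) (Finset.self_mem_range_succ k))
    have hle : ∑ i ∈ Finset.range (k + 1), a i ≤ ∑ i ∈ Finset.range m, a i :=
      Finset.sum_le_sum_of_subset_of_nonneg (Finset.range_mono (Finset.mem_Ico.1 hk).2)
        fun i _ _ => ha i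
    gcongr

/-- The Abel–Dini theorem. -/
theorem not_summable_div_sum_range_succ {a : ℕ → ℝ} (ha : ∀ k, 0 ≤ a k) (hns : ¬ Summable a) :
    ¬ Summable fun k => a k / ∑ i ∈ Finset.range (k + 1), a i := by
  intro hs
  have hS := (not_summable_iff_tendsto_nat_atTop_of_nonneg ha).1 hns
  obtain ⟨N, hN⟩ := Metric.cauchySeq_iff'.1 hs.hasSum.tendsto_sum_nat.cauchySeq (1 / 2) one_half_pos
  obtain ⟨m, hNm, hlarge, hpos⟩ := ((eventually_ge_atTop N).and
    ((hS.eventually_ge_atTop (2 * ∑ i ∈ Finset.range N, a i)).and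
      (hS.eventually_gt_atTop 0))).exists
  have htail := hN m hNm
  rw [Real.dist_eq, ← Finset.sum_Ico_eq_sub _ hNm] at htail
  have hratio : (∑ i ∈ Finset.range N, a i) / ∑ i ∈ Finset.range m, a i ≤ 1 / 2 := by
    rw [div_le_iff₀ hpos]
    linarith
  linarith [one_sub_div_le_sum_Ico_div ha hNm hpos, (abs_lt.1 htail).2]

/-- Otherwise, by Abel–Dini, `c k = sign (a k) / (|a 0| + ⋯ + |a k|)` would be a counterexample. -/
theorem summable_abs_of_forall_tendsto_zero {a : ℕ → ℝ}
    (h : ∀ c : ℕ → ℝ, Tendsto c atTop (𝓝 0) →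
      ∃ s, Tendsto (fun m => ∑ k ∈ Finset.range m, a k * c k) atTop (𝓝 s)) :
    Summable fun k => |a k| := by
  by_contra hns
  set S : ℕ → ℝ := fun k => ∑ i ∈ Finset.range (k + 1), |a i|
  have hS : Tendsto S atTop atTop :=
    ((not_summable_iff_tendsto_nat_atTop_of_nonneg fun k => abs_nonneg (a k)).1 hns).comp
      (tendsto_add_atTop_nat 1)
  have hc : Tendsto (fun k => (SignType.sign (a k) : ℝ) * (S k)⁻¹) atTop (𝓝 0) := by
    refine squeeze_zero_norm (fun k => ?_) (tendsto_norm_zero.comp hS.inv_tendsto_atTop)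
    rw [norm_mul]
    refine mul_le_of_le_one_left (norm_nonneg _) ?_
    rcases lt_trichotomy (a k) 0 with hk | hk | hk <;> simp [hk]
  obtain ⟨s, hs⟩ := h _ hc
  have hterm : ∀ k, a k * (SignType.sign (a k) * (S k)⁻¹) = |a k| / S k := fun k => by
    rw [← mul_assoc, self_mul_sign, div_eq_mul_inv]
  simp only [hterm] at hs
  have hnonneg : ∀ k, 0 ≤ |a k| / S k := fun k => by positivity
  exact not_summable_div_sum_range_succ (fun k => abs_nonneg (a k)) hns
    ((hasSum_iff_tendsto_nat_of_nonneg hnonneg s).2 hs).summable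

/-- The transform `A x` computed with unconditional sums; entry `n` has the junk value `0` unless
`∑ k, A n k * x k` converges absolutely. -/
noncomputable def tsumTransform (A : Matrix ℕ ℕ ℝ) (x : ℕ → ℝ) (n : ℕ) : ℝ :=
  ∑' k, A n k * x k

namespace HasTransform

variable {A : Matrix ℕ ℕ ℝ} {x y : ℕ → ℝ}

theorem eq_tsumTransform (h : HasTransform A x y) (hs : ∀ n, Summable fun k => A n k * x k) :
    y = tsumTransform A x :=
  funext fun n => tendsto_nhds_unique (h n) (hs n).hasSum.tendsto_sum_nat

theorem tendsto_mul_zero (h : HasTransform A x y) (n : ℕ) :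
    Tendsto (fun k => A n k * x k) atTop (𝓝 0) := by
  simpa [Finset.sum_range_succ] using ((h n).comp (tendsto_add_atTop_nat 1)).sub (h n)

end HasTransform

namespace IsRegularMatrix

variable {A : Matrix ℕ ℕ ℝ}

theorem one : IsRegularMatrix (1 : Matrix ℕ ℕ ℝ) := by
  refine fun x l hx => ⟨x, fun n => tendsto_const_nhds.congr' ?_, hx⟩
  filter_upwards [eventually_gt_atTop n] with m hm
  simp [Matrix.one_apply, hm]

theorem summable_abs (hA : IsRegularMatrix A) (n : ℕ) : Summable fun k => |A n k| :=
  summable_abs_of_forall_tendsto_zero fun c hc =>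
    let ⟨y, hy, _⟩ := hA c 0 hc
    ⟨y n, hy n⟩

theorem eventually_exists_ne_zero (hA : IsRegularMatrix A) (p : ℕ) :
    ∀ᶠ n in atTop, ∃ k ≥ p, A n k ≠ 0 := by
  have htail : Tendsto ((Ici p).indicator (1 : ℕ → ℝ)) atTop (𝓝 1) := by
    refine tendsto_const_nhds.congr' ?_
    filter_upwards [eventually_ge_atTop p] with k hk
    exact (indicator_of_mem (mem_Ici.2 hk) 1).symm
  obtain ⟨y, hy, hlim⟩ := hA _ 1 htail
  filter_upwards [hlim.eventually_ne one_ne_zero] with n hn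
  by_contra! hzero
  have hterm : ∀ k, A n k * (Ici p).indicator (1 : ℕ → ℝ) k = 0 := fun k => by
    by_cases hk : p ≤ k
    · rw [hzero k hk, zero_mul]
    · rw [indicator_of_notMem (notMem_Ici.2 (not_le.1 hk)), mul_zero]
  refine hn (tendsto_nhds_unique (hy n) ?_)
  simp only [hterm, Finset.sum_const_zero, tendsto_const_nhds]

theorem statSummableSubseqs_eq_univ (hA : IsRegularMatrix A) {x : ℕ → ℝ} {l : ℝ}
    (hx : Tendsto x atTop (𝓝 l)) : statSummableSubseqs A x = univ := by
  refine eq_univ_of_forall fun σ => ?_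
  obtain ⟨y, hy, hlim⟩ := hA _ l (hx.comp σ.2.tendsto_atTop)
  exact ⟨y, hy, statisticallyConvergent_of_tendsto hlim⟩

end IsRegularMatrix

section BoundedSequences

variable {A : Matrix ℕ ℕ ℝ} {x : ℕ → ℝ} {B : ℝ}

theorem exists_mapClusterPt_ne {ι X : Type*} [TopologicalSpace X] {f : Filter ι} [f.NeBot]
    {K : Set X} (hK : IsCompact K) {u : ι → X} (hu : ∀ᶠ i in f, u i ∈ K)
    (hdiv : ¬ ∃ l, Tendsto u f (𝓝 l)) :
    ∃ l₁ l₂, l₁ ≠ l₂ ∧ MapClusterPt l₁ f u ∧ MapClusterPt l₂ f u := by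
  obtain ⟨l, -, hl⟩ := hK.exists_mapClusterPt_of_frequently hu.frequently
  by_contra! hall
  exact hdiv ⟨l, hK.tendsto_nhds_of_unique_mapClusterPt hu
    fun m _ hm => by_contra fun hne => hall l m (Ne.symm hne) hl hm⟩

namespace IsRegularMatrix

theorem summable_mul (hA : IsRegularMatrix A) (hB : ∀ k, |x k| ≤ B) (n : ℕ) :
    Summable fun k => A n k * x k :=
  ((hA.summable_abs n).mul_right B).of_norm_bounded fun k => norm_mul_le_of_le le_rfl (hB k)

theorem continuous_tsumTransform_comp (hA : IsRegularMatrix A) (hB : ∀ k, |x k| ≤ B) (n : ℕ) :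
    Continuous fun σ : IncreasingMaps => tsumTransform A (fun k => x (σ.1 k)) n :=
  continuous_tsum (fun k => continuous_const.mul (IncreasingMaps.continuous_comp_apply x k))
    ((hA.summable_abs n).mul_right B) fun _ _ => norm_mul_le_of_le le_rfl (hB _)

theorem eventually_residual_hasLongBlocks_dist_lt (hA : IsRegularMatrix A) (hB : ∀ k, |x k| ≤ B)
    {l : ℝ} (hl : MapClusterPt l atTop x) {ε : ℝ} (hε : 0 < ε) :
    ∀ᶠ σ : IncreasingMaps in residual _,
      HasLongBlocks {n | dist (tsumTransform A (fun k => x (σ.1 k)) n) l < ε} := by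
  refine IncreasingMaps.eventually_residual_hasLongBlocks
    (fun n => isOpen_lt ((hA.continuous_tsumTransform_comp hB n).dist continuous_const)
      continuous_const) fun σ p => ?_
  obtain ⟨τ, hτ, hlim⟩ := IncreasingMaps.exists_eqOn_Iio_tendsto hl σ p
  obtain ⟨y, hy, hylim⟩ := hA _ l hlim
  obtain rfl := hy.eq_tsumTransform (hA.summable_mul fun _ => hB _)
  obtain ⟨a, ha⟩ := Metric.tendsto_atTop.1 hylim ε hε
  exact ⟨a, fun b => ⟨τ, hτ, fun n hn => ha n hn.1⟩⟩

theorem isMeagre_statSummableSubseqs_of_bounded (hA : IsRegularMatrix A) (hB : ∀ k, |x k| ≤ B)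
    (hx : ¬ ∃ l, Tendsto x atTop (𝓝 l)) : IsMeagre (statSummableSubseqs A x) := by
  obtain ⟨l₁, l₂, hne, h₁, h₂⟩ := exists_mapClusterPt_ne isCompact_Icc
    (Eventually.of_forall fun k => abs_le.1 (hB k)) hx
  have hε : 0 < dist l₁ l₂ / 4 := div_pos (dist_pos.2 hne) (by norm_num)
  filter_upwards [hA.eventually_residual_hasLongBlocks_dist_lt hB h₁ hε,
    hA.eventually_residual_hasLongBlocks_dist_lt hB h₂ hε] with σ hσ₁ hσ₂
  rintro ⟨y, hy, η, hη⟩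
  obtain rfl := hy.eq_tsumTransform (hA.summable_mul fun _ => hB _)
  linarith [dist_triangle_right l₁ l₂ η, hσ₁.dist_lt (hη _ hε), hσ₂.dist_lt (hη _ hε)]

end IsRegularMatrix

end BoundedSequences

/-- Every row of `A` has only finitely many nonzero entries. -/
def IsRowFinite (A : Matrix ℕ ℕ ℝ) : Prop :=
  ∀ n, ∀ᶠ k in atTop, A n k = 0

namespace IsRowFinite

variable {A : Matrix ℕ ℕ ℝ}

theorem eventually_hasSum (hA : IsRowFinite A) (n : ℕ) :
    ∀ᶠ K in atTop, ∀ x : ℕ → ℝ,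
      HasSum (fun k => A n k * x k) (∑ k ∈ Finset.range K, A n k * x k) := by
  filter_upwards [eventually_forall_ge_atTop.2 (hA n)] with K hK x
  refine hasSum_sum_of_ne_finset_zero fun k hk => ?_
  rw [hK k (by simpa using hk), zero_mul]

theorem summable_mul (hA : IsRowFinite A) (x : ℕ → ℝ) (n : ℕ) : Summable fun k => A n k * x k :=
  let ⟨_, hK⟩ := (hA.eventually_hasSum n).exists
  (hK x).summable

theorem continuous_tsumTransform_comp (hA : IsRowFinite A) (x : ℕ → ℝ) (n : ℕ) :
    Continuous fun σ : IncreasingMaps => tsumTransform A (fun k => x (σ.1 k)) n := by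
  obtain ⟨K, hK⟩ := (hA.eventually_hasSum n).exists
  simp only [tsumTransform, (hK _).tsum_eq]
  exact continuous_finsetSum _ fun k _ =>
    continuous_const.mul (IncreasingMaps.continuous_comp_apply x k)

end IsRowFinite

section UnboundedSequences

theorem frequently_forall_lt_abs_add_mul {α ι : Type*} {f : Filter α} {u : α → ℝ}
    (hu : ∀ B, ∃ᶠ m in f, B < |u m|) (s : Finset ι) (b c : ι → ℝ) (M : ℝ) :
    ∃ᶠ m in f, ∀ i ∈ s, c i ≠ 0 → M < |b i + c i * u m| := by
  have hr : ∀ i ∈ s, 0 ≤ (|M| + |b i|) / |c i| := fun i _ => by positivity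
  refine (hu (∑ i ∈ s, (|M| + |b i|) / |c i|)).mono fun m hm i hi hci => ?_
  have hlt : (|M| + |b i|) / |c i| < |u m| := (Finset.single_le_sum hr hi).trans_lt hm
  rw [div_lt_iff₀ (abs_pos.2 hci), mul_comm, ← abs_mul] at hlt
  have htri := abs_sub_abs_le_abs_add (c i * u m) (b i)
  rw [add_comm (c i * u m)] at htri
  linarith [le_abs_self M]

variable {A : Matrix ℕ ℕ ℝ} {x : ℕ → ℝ}

theorem isMeagre_setOf_hasTransform_of_frequently_ne_zero {n : ℕ}
    (hn : ∃ᶠ k in atTop, A n k ≠ 0) (hx : ∀ B, ∃ᶠ m in atTop, B < |x m|) :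
    IsMeagre {σ : IncreasingMaps | ∃ y : ℕ → ℝ, HasTransform A (fun n => x (σ.1 n)) y} := by
  have hgen : ∀ᶠ σ : IncreasingMaps in residual _, ∃ᶠ k in atTop, 1 < |A n k * x (σ.1 k)| := by
    refine IncreasingMaps.eventually_residual_frequently_mem (fun k => isOpen_lt continuous_const
      (continuous_const.mul (IncreasingMaps.continuous_comp_apply x k)).abs) fun σ p => ?_
    refine (hn.and_eventually (eventually_ge_atTop p)).mono fun k ⟨hne, hpk⟩ => ?_
    obtain ⟨m, hm, hlt⟩ := frequently_atTop.1 (hx (1 / |A n k|)) (σ.1 k)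
    obtain ⟨τ, hτ, rfl⟩ := σ.exists_eqOn_Iio_apply_eq hm
    refine ⟨τ, ?_, hτ.mono (Iio_subset_Iio hpk)⟩
    rw [div_lt_iff₀' (abs_pos.2 hne), ← abs_mul] at hlt
    exact hlt
  filter_upwards [hgen] with σ hσ
  rintro ⟨y, hy⟩
  have hsmall := (hy.tendsto_mul_zero n).abs.eventually_lt_const (abs_zero.trans_lt one_pos)
  obtain ⟨k, hlarge, hk⟩ := (hσ.and_eventually hsmall).exists
  exact lt_asymm hlarge hk

theorem exists_eqOn_Iio_forall_lt_abs_sum (hx : ∀ B, ∃ᶠ m in atTop, B < |x m|) (M : ℝ)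
    (s : Finset ℕ) (σ : IncreasingMaps) {p K : ℕ} (hpK : p ≤ K) :
    ∃ τ : IncreasingMaps, EqOn τ.1 σ.1 (Iio p) ∧ ∀ n ∈ s, (∃ k ∈ Ico p K, A n k ≠ 0) →
      M < |∑ k ∈ Finset.range K, A n k * x (τ.1 k)| := by
  induction K, hpK using Nat.le_induction with
  | base =>
    refine ⟨σ, eqOn_refl _ _, fun n _ ⟨k, hk, _⟩ => ?_⟩
    simp at hk
  | succ K hpK ih =>
    obtain ⟨τ, hτ, hlarge⟩ := ih
    obtain ⟨m, hm, hstep⟩ := frequently_atTop.1 (frequently_forall_lt_abs_add_mul hx s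
      (fun n => ∑ k ∈ Finset.range K, A n k * x (τ.1 k)) (fun n => A n K) M) (τ.1 K)
    obtain ⟨ρ, hρ, rfl⟩ := τ.exists_eqOn_Iio_apply_eq hm
    refine ⟨ρ, (hρ.mono (Iio_subset_Iio hpK)).trans hτ, fun n hn ⟨k, hk, hnk⟩ => ?_⟩
    have hinit : ∑ k ∈ Finset.range K, A n k * x (ρ.1 k) =
        ∑ k ∈ Finset.range K, A n k * x (τ.1 k) :=
      Finset.sum_congr rfl fun k hk => by rw [hρ (Finset.mem_range.1 hk)]
    rw [Finset.sum_range_succ, hinit]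
    by_cases hnK : A n K = 0
    · have hkK : k < K := (Nat.lt_succ_iff.1 hk.2).lt_of_ne fun h => hnk (h ▸ hnK)
      rw [hnK, zero_mul, add_zero]
      exact hlarge n hn ⟨k, ⟨hk.1, hkK⟩, hnk⟩
    · exact hstep n hn hnK

theorem IsRowFinite.exists_eqOn_Iio_forall_lt_abs_tsumTransform (hA : IsRowFinite A)
    (hx : ∀ B, ∃ᶠ m in atTop, B < |x m|) (M : ℝ) {p : ℕ} {s : Finset ℕ}
    (hs : ∀ n ∈ s, ∃ k ≥ p, A n k ≠ 0) (σ : IncreasingMaps) :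
    ∃ τ : IncreasingMaps, EqOn τ.1 σ.1 (Iio p) ∧
      ∀ n ∈ s, M < |tsumTransform A (fun k => x (τ.1 k)) n| := by
  obtain ⟨K, hpK, hzero, hsum⟩ := ((eventually_ge_atTop p).and
    (((Finset.eventually_all s).2 fun n _ => eventually_forall_ge_atTop.2 (hA n)).and
      ((Finset.eventually_all s).2 fun n _ => hA.eventually_hasSum n))).exists
  obtain ⟨τ, hτ, hlarge⟩ := exists_eqOn_Iio_forall_lt_abs_sum hx M s σ hpK
  refine ⟨τ, hτ, fun n hn => ?_⟩
  obtain ⟨k, hk, hnk⟩ := hs n hn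
  rw [tsumTransform, (hsum n hn _).tsum_eq]
  exact hlarge n hn ⟨k, ⟨hk, not_le.1 fun hKk => hnk (hzero n hn k hKk)⟩, hnk⟩

namespace IsRegularMatrix

theorem eventually_residual_hasLongBlocks_lt_abs (hA : IsRegularMatrix A) (hrow : IsRowFinite A)
    (hx : ∀ B, ∃ᶠ m in atTop, B < |x m|) (M : ℝ) :
    ∀ᶠ σ : IncreasingMaps in residual _,
      HasLongBlocks {n | M < |tsumTransform A (fun k => x (σ.1 k)) n|} := by
  refine IncreasingMaps.eventually_residual_hasLongBlocks (fun n => isOpen_lt continuous_const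
    (hrow.continuous_tsumTransform_comp x n).abs) fun σ p => ?_
  obtain ⟨a, ha⟩ := eventually_atTop.1 (hA.eventually_exists_ne_zero p)
  refine ⟨a, fun b => ?_⟩
  obtain ⟨τ, hτ, hlarge⟩ := hrow.exists_eqOn_Iio_forall_lt_abs_tsumTransform hx M
    (s := Finset.Ico a b) (fun n hn => ha n (Finset.mem_Ico.1 hn).1) σ
  exact ⟨τ, hτ, fun n hn => hlarge n (Finset.mem_Ico.2 hn)⟩

theorem isMeagre_statSummableSubseqs_of_isRowFinite (hA : IsRegularMatrix A)
    (hrow : IsRowFinite A) (hx : ∀ B, ∃ᶠ m in atTop, B < |x m|) :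
    IsMeagre (statSummableSubseqs A x) := by
  filter_upwards [eventually_countable_forall.2 fun M : ℕ =>
    hA.eventually_residual_hasLongBlocks_lt_abs hrow hx M] with σ hσ
  rintro ⟨y, hy, η, hη⟩
  obtain rfl := hy.eq_tsumTransform (hrow.summable_mul _)
  obtain ⟨M, hM⟩ := exists_nat_gt (|η| + 1)
  obtain ⟨n, hlarge, hnear⟩ := (hσ M).sdiff_nonempty (hη 1 one_pos)
  have hlarge' : (M : ℝ) < |tsumTransform A (fun k => x (σ.1 k)) n| := hlarge
  have hnear' : |tsumTransform A (fun k => x (σ.1 k)) n - η| ≤ 1 := not_lt.1 hnear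
  linarith [abs_sub_abs_le_abs_sub (tsumTransform A (fun k => x (σ.1 k)) n) η]

theorem isMeagre_statSummableSubseqs_of_unbounded (hA : IsRegularMatrix A)
    (hx : ∀ B, ∃ᶠ m in atTop, B < |x m|) : IsMeagre (statSummableSubseqs A x) := by
  by_cases hrow : IsRowFinite A
  · exact hA.isMeagre_statSummableSubseqs_of_isRowFinite hrow hx
  · obtain ⟨n, hn⟩ := not_forall.1 hrow
    have hinf : ∃ᶠ k in atTop, A n k ≠ 0 := not_eventually.1 hn
    refine (isMeagre_setOf_hasTransform_of_frequently_ne_zero hinf hx).mono ?_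
    rintro σ ⟨y, hy, -⟩
    exact ⟨y, hy⟩

end IsRegularMatrix

end UnboundedSequences

theorem IsRegularMatrix.isMeagre_statSummableSubseqs {A : Matrix ℕ ℕ ℝ} (hA : IsRegularMatrix A)
    {x : ℕ → ℝ} (hx : ¬ ∃ l, Tendsto x atTop (𝓝 l)) : IsMeagre (statSummableSubseqs A x) := by
  by_cases hb : IsBoundedUnder (· ≤ ·) atTop fun k => |x k|
  · obtain ⟨B, hB⟩ := hb.bddAbove_range
    exact hA.isMeagre_statSummableSubseqs_of_bounded (fun k => hB (mem_range_self k)) hx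
  · refine hA.isMeagre_statSummableSubseqs_of_unbounded fun B hB => hb ?_
    exact isBoundedUnder_of_eventually_le (hB.mono fun k hk => not_lt.1 hk)

theorem corollary2p3 (x : ℕ → ℝ) :
    (∃ l : ℝ, Tendsto x atTop (𝓝 l)) ↔
      ∃ A : Matrix ℕ ℕ ℝ, IsRegularMatrix A ∧
        ¬ IsMeagre {σ : IncreasingMaps |
          ∃ y : ℕ → ℝ, HasTransform A (fun n => x (σ.1 n)) y ∧ StatisticallyConvergent y} := by
  constructor
  · rintro ⟨l, hl⟩
    refine ⟨1, IsRegularMatrix.one, ?_⟩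
    change ¬ IsMeagre (statSummableSubseqs 1 x)
    rw [IsRegularMatrix.one.statSummableSubseqs_eq_univ hl]
    exact not_isMeagre_of_isOpen isOpen_univ ⟨⟨id, strictMono_id⟩, trivial⟩
  · rintro ⟨A, hA, hnonmeagre⟩
    by_contra hx
    exact hnonmeagre (hA.isMeagre_statSummableSubseqs hx)
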